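/- A $C^\infty$-ring is a set $A$ together with an operation $A^n\to A$ for every $n\ge 0$ and every smooth $f:\mathbb R^n\to\mathbb R$, compatible with projections and composition; in particular $A$ is a commutative $\mathbb R$-algebra. It is finitely generated if it is a quotient of $C^\infty(\mathbb R^n)$ for some $n$, and local if it has a unique maximal ideal $\mathfrak m$ and $A/\mathfrak m\cong\mathbb R$. A sheaf $F$ on a topological space $X$ is soft if, for every closed $S\subseteq X$, every section of $F$ over $S$ (a family of germs at the points of $S$ that near each point of $S$ is induced by a section of $F$ over an open set) extends to a global section. A $C^\infty$-space is a Hausdorff space $X$ with a soft sheaf of finitely generated $C^\infty$-rings all of whose stalks are local. Let $X$ be a topological space and $\mathcal O_{\bullet,X}=\{\mathcal O_{k,X}\}_{k\ge0}$ a sheaf of simplicial $C^\infty$-rings on $X$. Let $\pi_0(\mathcal O_{\bullet,X})$ be the sheaf associated to the presheaf $U\mapsto\pi_0(\Gamma(U,\mathcal O_{\bullet,X}))$, where $\pi_0(A_\bullet)$ denotes the quotient of $A_0$ by the congruence defined by the two face maps $A_1\to A_0$. Proposition. Let $(X,\mathcal O_{\bullet,X})$ be a localized simplicial $C^\infty$-space,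 i.e. $(X,\pi_0(\mathcal O_{\bullet,X}))$ is a $C^\infty$-space and all stalks of $\mathcal O_{0,X}$ are local $C^\infty$-rings. Then $\mathcal O_{0,X}$ is a soft sheaf. -/

import Mathlib

open CategoryTheory TopologicalSpace
open scoped ContDiff Simplicial

universe u v w

/-! ## Smooth functions and C^∞-rings -/

/-- The set `C^∞(ℝⁿ)` of smooth real functions on `ℝⁿ`. -/
def SmoothFun (n : ℕ) : Type := {f : (Fin n → ℝ) → ℝ // ContDiff ℝ ∞ f}

namespace SmoothFun

/-- The `i`-th coordinate function on `ℝⁿ`. -/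
def proj {n : ℕ} (i : Fin n) : SmoothFun n := ⟨fun x => x i, by fun_prop⟩

/-- The composite `x ↦ f (g₁ x, …, gₘ x)`. -/
def comp {m n : ℕ} (f : SmoothFun m) (g : Fin m → SmoothFun n) : SmoothFun n :=
  ⟨fun x => f.1 (fun j => (g j).1 x), f.2.comp (contDiff_pi.2 fun j => (g j).2)⟩

/-- The constant function `r` on `ℝⁿ`. -/
def const (n : ℕ) (r : ℝ) : SmoothFun n := ⟨fun _ => r, contDiff_const⟩

/-- Pointwise sum. -/
def add {n : ℕ} (f g : SmoothFun n) : SmoothFun n := ⟨fun x => f.1 x + g.1 x, f.2.add g.2⟩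

/-- Pointwise product. -/
def mul {n : ℕ} (f g : SmoothFun n) : SmoothFun n := ⟨fun x => f.1 x * g.1 x, f.2.mul g.2⟩

/-- Pointwise negative. -/
def neg {n : ℕ} (f : SmoothFun n) : SmoothFun n := ⟨fun x => -f.1 x, f.2.neg⟩

end SmoothFun

/-- A `C^∞`-ring structure on a set `A`: every smooth `f : ℝⁿ → ℝ` acts as an operation
`Aⁿ → A`, compatibly with projections and composition.  This is the same as a
product-preserving functor from the category of the spaces `ℝⁿ` and smooth maps to sets,
with value `A` at `ℝ`. -/
class CInfRing (A : Type u) where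
  /-- The operation of a smooth function of `n` variables. -/
  act : ∀ {n : ℕ}, SmoothFun n → (Fin n → A) → A
  act_proj : ∀ {n : ℕ} (i : Fin n) (a : Fin n → A), act (SmoothFun.proj i) a = a i
  act_comp : ∀ {m n : ℕ} (f : SmoothFun m) (g : Fin m → SmoothFun n) (a : Fin n → A),
    act (f.comp g) a = act f (fun j => act (g j) a)

namespace CInfRing

/-- The free `C^∞`-ring `C^∞(ℝⁿ)` on `n` generators; smooth functions act by composition. -/
instance (n : ℕ) : CInfRing (SmoothFun n) where
  act f g := f.comp g
  act_proj _ _ := rfl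
  act_comp _ _ _ := rfl

/-- A morphism of `C^∞`-rings: a map commuting with the action of all smooth functions. -/
@[ext]
structure Hom (A : Type u) (B : Type v) [CInfRing A] [CInfRing B] where
  /-- The underlying map. -/
  toFun : A → B
  map_act : ∀ {n : ℕ} (f : SmoothFun n) (a : Fin n → A),
    toFun (act f a) = act f (fun i => toFun (a i))

instance (A : Type u) (B : Type v) [CInfRing A] [CInfRing B] : FunLike (Hom A B) A B where
  coe f := f.toFun
  coe_injective _ _ h := Hom.ext h

/-- The identity morphism. -/
def Hom.id (A : Type u) [CInfRing A] : Hom A A := ⟨fun a => a, fun _ _ => rfl⟩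

/-- Composition of morphisms. -/
def Hom.comp {A : Type u} {B : Type v} {C : Type w} [CInfRing A] [CInfRing B] [CInfRing C]
    (g : Hom B C) (f : Hom A B) : Hom A C :=
  ⟨fun a => g.toFun (f.toFun a), fun h a => by rw [f.map_act, g.map_act]⟩

/-- A `C^∞`-ring is finitely generated if it is a quotient of some `C^∞(ℝⁿ)`. -/
def FinitelyGenerated (A : Type u) [CInfRing A] : Prop :=
  ∃ (n : ℕ) (φ : Hom (SmoothFun n) A), Function.Surjective φ

section Ring

variable {A : Type u} [CInfRing A]

/-- Addition: the operation of `(x, y) ↦ x + y`. -/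
def addOp (a b : A) : A := act ((SmoothFun.proj 0).add (SmoothFun.proj 1) : SmoothFun 2) ![a, b]

/-- Multiplication: the operation of `(x, y) ↦ x * y`. -/
def mulOp (a b : A) : A := act ((SmoothFun.proj 0).mul (SmoothFun.proj 1) : SmoothFun 2) ![a, b]

/-- Negation: the operation of `x ↦ -x`. -/
def negOp (a : A) : A := act ((SmoothFun.proj 0).neg : SmoothFun 1) ![a]

variable (A) in
/-- Constants: the operation of the function `r` on `ℝ⁰`. -/
def constOp (r : ℝ) : A := act (SmoothFun.const 0 r) ![]

theorem addOp_act {n : ℕ} (f g : SmoothFun n) (a : Fin n → A) :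
    addOp (act f a) (act g a) = act (f.add g) a := by
  have h : f.add g =
      ((SmoothFun.proj 0).add (SmoothFun.proj 1) : SmoothFun 2).comp ![f, g] := rfl
  rw [h, act_comp, addOp]
  congr 1
  funext j
  fin_cases j <;> rfl

theorem mulOp_act {n : ℕ} (f g : SmoothFun n) (a : Fin n → A) :
    mulOp (act f a) (act g a) = act (f.mul g) a := by
  have h : f.mul g =
      ((SmoothFun.proj 0).mul (SmoothFun.proj 1) : SmoothFun 2).comp ![f, g] := rfl
  rw [h, act_comp, mulOp]
  congr 1
  funext j
  fin_cases j <;> rfl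

theorem negOp_act {n : ℕ} (f : SmoothFun n) (a : Fin n → A) :
    negOp (act f a) = act f.neg a := by
  have h : f.neg = ((SmoothFun.proj 0).neg : SmoothFun 1).comp ![f] := rfl
  rw [h, act_comp, negOp]
  congr 1
  funext j
  fin_cases j; rfl

theorem constOp_eq {n : ℕ} (r : ℝ) (a : Fin n → A) :
    constOp A r = act (SmoothFun.const n r) a := by
  have h : SmoothFun.const n r = (SmoothFun.const 0 r).comp ![] := rfl
  rw [h, act_comp, constOp]
  congr 1
  funext j
  exact j.elim0

/-- Elements `a 0, …, a (n-1)` written through the coordinate functions. -/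
theorem eq_act_proj {n : ℕ} (a : Fin n → A) (i : Fin n) : a i = act (SmoothFun.proj i) a :=
  (act_proj i a).symm

variable (A) in
/-- The underlying commutative ring of a `C^∞`-ring. -/
@[reducible]
def commRing : CommRing A where
  add := addOp
  mul := mulOp
  neg := negOp
  zero := constOp A 0
  one := constOp A 1
  nsmul := @nsmulRec A ⟨constOp A 0⟩ ⟨addOp⟩
  zsmul := @zsmulRec A ⟨constOp A 0⟩ ⟨addOp⟩ ⟨negOp⟩ (@nsmulRec A ⟨constOp A 0⟩ ⟨addOp⟩)
  npow := @npowRec A ⟨constOp A 1⟩ ⟨mulOp⟩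
  add_assoc a b c := by
    change addOp (addOp a b) c = addOp a (addOp b c)
    have h0 := eq_act_proj ![a, b, c] 0
    have h1 := eq_act_proj ![a, b, c] 1
    have h2 := eq_act_proj ![a, b, c] 2
    simp only [Matrix.cons_val] at h0 h1 h2
    generalize ![a, b, c] = v at h0 h1 h2
    rw [h0, h1, h2]; simp only [addOp_act]
    congr 1; apply Subtype.ext; funext x; simp [SmoothFun.add, add_assoc]
  add_comm a b := by
    change addOp a b = addOp b a
    have h0 := eq_act_proj ![a, b] 0
    have h1 := eq_act_proj ![a, b] 1
    simp only [Matrix.cons_val] at h0 h1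
    generalize ![a, b] = v at h0 h1
    rw [h0, h1]; simp only [addOp_act]
    congr 1; apply Subtype.ext; funext x; simp [SmoothFun.add, add_comm]
  zero_add a := by
    change addOp (constOp A 0) a = a
    have h0 := eq_act_proj ![a] 0
    simp only [Matrix.cons_val] at h0
    generalize ![a] = v at h0
    rw [h0, constOp_eq 0 v]; simp only [addOp_act]
    congr 1; apply Subtype.ext; funext x; simp [SmoothFun.add, SmoothFun.const]
  add_zero a := by
    change addOp a (constOp A 0) = a
    have h0 := eq_act_proj ![a] 0
    simp only [Matrix.cons_val] at h0
    generalize ![a] = v at h0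
    rw [h0, constOp_eq 0 v]; simp only [addOp_act]
    congr 1; apply Subtype.ext; funext x; simp [SmoothFun.add, SmoothFun.const]
  neg_add_cancel a := by
    change addOp (negOp a) a = constOp A 0
    have h0 := eq_act_proj ![a] 0
    simp only [Matrix.cons_val] at h0
    generalize ![a] = v at h0
    rw [h0, constOp_eq 0 v]; simp only [negOp_act, addOp_act]
    congr 1; apply Subtype.ext; funext x
    simp [SmoothFun.add, SmoothFun.neg, SmoothFun.const]
  mul_assoc a b c := by
    change mulOp (mulOp a b) c = mulOp a (mulOp b c)
    have h0 := eq_act_proj ![a, b, c] 0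
    have h1 := eq_act_proj ![a, b, c] 1
    have h2 := eq_act_proj ![a, b, c] 2
    simp only [Matrix.cons_val] at h0 h1 h2
    generalize ![a, b, c] = v at h0 h1 h2
    rw [h0, h1, h2]; simp only [mulOp_act]
    congr 1; apply Subtype.ext; funext x; simp [SmoothFun.mul, mul_assoc]
  mul_comm a b := by
    change mulOp a b = mulOp b a
    have h0 := eq_act_proj ![a, b] 0
    have h1 := eq_act_proj ![a, b] 1
    simp only [Matrix.cons_val] at h0 h1
    generalize ![a, b] = v at h0 h1
    rw [h0, h1]; simp only [mulOp_act]
    congr 1; apply Subtype.ext; funext x; simp [SmoothFun.mul, mul_comm]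
  one_mul a := by
    change mulOp (constOp A 1) a = a
    have h0 := eq_act_proj ![a] 0
    simp only [Matrix.cons_val] at h0
    generalize ![a] = v at h0
    rw [h0, constOp_eq 1 v]; simp only [mulOp_act]
    congr 1; apply Subtype.ext; funext x; simp [SmoothFun.mul, SmoothFun.const]
  mul_one a := by
    change mulOp a (constOp A 1) = a
    have h0 := eq_act_proj ![a] 0
    simp only [Matrix.cons_val] at h0
    generalize ![a] = v at h0
    rw [h0, constOp_eq 1 v]; simp only [mulOp_act]
    congr 1; apply Subtype.ext; funext x; simp [SmoothFun.mul, SmoothFun.const]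
  zero_mul a := by
    change mulOp (constOp A 0) a = constOp A 0
    have h0 := eq_act_proj ![a] 0
    simp only [Matrix.cons_val] at h0
    generalize ![a] = v at h0
    rw [h0, constOp_eq 0 v]; simp only [mulOp_act]
    congr 1; apply Subtype.ext; funext x; simp [SmoothFun.mul, SmoothFun.const]
  mul_zero a := by
    change mulOp a (constOp A 0) = constOp A 0
    have h0 := eq_act_proj ![a] 0
    simp only [Matrix.cons_val] at h0
    generalize ![a] = v at h0
    rw [h0, constOp_eq 0 v]; simp only [mulOp_act]
    congr 1; apply Subtype.ext; funext x; simp [SmoothFun.mul, SmoothFun.const]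
  left_distrib a b c := by
    change mulOp a (addOp b c) = addOp (mulOp a b) (mulOp a c)
    have h0 := eq_act_proj ![a, b, c] 0
    have h1 := eq_act_proj ![a, b, c] 1
    have h2 := eq_act_proj ![a, b, c] 2
    simp only [Matrix.cons_val] at h0 h1 h2
    generalize ![a, b, c] = v at h0 h1 h2
    rw [h0, h1, h2]; simp only [mulOp_act, addOp_act]
    congr 1; apply Subtype.ext; funext x; simp [SmoothFun.mul, SmoothFun.add, mul_add]
  right_distrib a b c := by
    change mulOp (addOp a b) c = addOp (mulOp a c) (mulOp b c)
    have h0 := eq_act_proj ![a, b, c] 0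
    have h1 := eq_act_proj ![a, b, c] 1
    have h2 := eq_act_proj ![a, b, c] 2
    simp only [Matrix.cons_val] at h0 h1 h2
    generalize ![a, b, c] = v at h0 h1 h2
    rw [h0, h1, h2]; simp only [mulOp_act, addOp_act]
    congr 1; apply Subtype.ext; funext x; simp [SmoothFun.mul, SmoothFun.add, add_mul]

variable (A) in
/-- The underlying commutative `ℝ`-algebra of a `C^∞`-ring; `r : ℝ` goes to the constant `r`. -/
@[reducible]
def algebra : letI := commRing A; Algebra ℝ A :=
  letI := commRing A
  RingHom.toAlgebra
    { toFun := constOp A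
      map_one' := rfl
      map_zero' := rfl
      map_add' := fun r s => (addOp_act (SmoothFun.const 0 r) (SmoothFun.const 0 s) ![]).symm
      map_mul' := fun r s => (mulOp_act (SmoothFun.const 0 r) (SmoothFun.const 0 s) ![]).symm }

end Ring

/-- A `C^∞`-ring `A` is local if it has exactly one maximal ideal `m` and `A / m ≅ ℝ`.
(An isomorphism of `ℝ`-algebras `A / m ≅ ℝ` is automatically one of `C^∞`-rings.) -/
def IsLocal (A : Type u) [CInfRing A] : Prop :=
  letI := commRing A
  letI := algebra A
  ∃ m : Ideal A, (∀ m' : Ideal A, m'.IsMaximal ↔ m' = m) ∧ Nonempty ((A ⧸ m) ≃ₐ[ℝ] ℝ)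

end CInfRing

/-- The category of `C^∞`-rings: objects. -/
structure CInfRingCat : Type (u + 1) where
  /-- The underlying set. -/
  carrier : Type u
  [str : CInfRing carrier]

namespace CInfRingCat

attribute [instance] CInfRingCat.str

instance : CoeSort CInfRingCat.{u} (Type u) := ⟨CInfRingCat.carrier⟩

instance : Category CInfRingCat.{u} where
  Hom A B := CInfRing.Hom A B
  id A := CInfRing.Hom.id A
  comp f g := CInfRing.Hom.comp g f

instance : ConcreteCategory CInfRingCat.{u} (fun A B => CInfRing.Hom A B) where
  hom f := f
  ofHom f := f

end CInfRingCat

/-! ## `π₀` of a simplicial C^∞-ring -/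

namespace CInfRing

/-- The function `x - y + z` of three variables. -/
def malcev : SmoothFun 3 :=
  ((SmoothFun.proj 0).add (SmoothFun.proj 1).neg).add (SmoothFun.proj 2)

theorem act_malcev_left {A : Type u} [CInfRing A] (a b : A) : act malcev ![a, a, b] = b := by
  have h : ![a, a, b] = fun j => act (![SmoothFun.proj 0, SmoothFun.proj 0,
      SmoothFun.proj 1] j : SmoothFun 2) ![a, b] := by
    funext j
    fin_cases j <;> simp [act_proj]
  have h2 : malcev.comp ![SmoothFun.proj 0, SmoothFun.proj 0, SmoothFun.proj 1] =
      (SmoothFun.proj 1 : SmoothFun 2) := by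
    apply Subtype.ext; funext x
    simp [malcev, SmoothFun.comp, SmoothFun.add, SmoothFun.neg, SmoothFun.proj]
  rw [h, ← act_comp, h2, act_proj]; rfl

theorem act_malcev_right {A : Type u} [CInfRing A] (a b : A) : act malcev ![a, b, b] = a := by
  have h : ![a, b, b] = fun j => act (![SmoothFun.proj 0, SmoothFun.proj 1,
      SmoothFun.proj 1] j : SmoothFun 2) ![a, b] := by
    funext j
    fin_cases j <;> simp [act_proj]
  have h2 : malcev.comp ![SmoothFun.proj 0, SmoothFun.proj 1, SmoothFun.proj 1] =
      (SmoothFun.proj 0 : SmoothFun 2) := by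
    apply Subtype.ext; funext x
    simp [malcev, SmoothFun.comp, SmoothFun.add, SmoothFun.neg, SmoothFun.proj]
  rw [h, ← act_comp, h2, act_proj]; rfl

theorem Hom.map_malcev {A : Type u} {B : Type v} [CInfRing A] [CInfRing B] (φ : Hom A B)
    (a b c : A) : φ (act malcev ![a, b, c]) = act malcev ![φ a, φ b, φ c] := by
  refine (φ.map_act _ _).trans (congrArg _ ?_)
  funext j
  fin_cases j <;> rfl

end CInfRing

namespace SimplicialCInfRing

open CInfRing

variable (A : SimplicialObject CInfRingCat.{u})

theorem d_s (i : Fin 2) (a : A.obj (.op ⦋0⦌)) : A.δ i (A.σ 0 a) = a := by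
  have h : A.σ (0 : Fin 1) ≫ A.δ i = 𝟙 _ := by
    fin_cases i
    · exact A.δ_comp_σ_self (i := 0)
    · exact A.δ_comp_σ_succ (i := 0)
  rw [← ConcreteCategory.comp_apply, h]; rfl

/-- The congruence on `A₀` defined by the two face maps `A₁ → A₀`: `a ∼ b` if and only if
`a` and `b` are the two faces of some element of `A₁`. -/
def homotopic : Setoid (A.obj (.op ⦋0⦌)) where
  r a b := ∃ s : A.obj (.op ⦋1⦌), A.δ 1 s = a ∧ A.δ 0 s = b
  iseqv :=
    { refl := fun a => ⟨A.σ 0 a, d_s A 1 a, d_s A 0 a⟩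
      symm := by
        rintro a b ⟨s, rfl, rfl⟩
        refine ⟨act malcev ![A.σ 0 (A.δ 0 s), s, A.σ 0 (A.δ 1 s)], ?_, ?_⟩
        · refine (Hom.map_malcev (A.δ 1) _ _ _).trans ?_
          erw [d_s, d_s]; exact act_malcev_right _ _
        · refine (Hom.map_malcev (A.δ 0) _ _ _).trans ?_
          erw [d_s, d_s]; exact act_malcev_left _ _
      trans := by
        rintro a b c ⟨s, rfl, hs⟩ ⟨t, ht, rfl⟩
        refine ⟨act malcev ![s, A.σ 0 b, t], ?_, ?_⟩
        · refine (Hom.map_malcev (A.δ 1) _ _ _).trans ?_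
          erw [d_s, ht]; exact act_malcev_right _ _
        · refine (Hom.map_malcev (A.δ 0) _ _ _).trans ?_
          erw [d_s, hs]; exact act_malcev_left _ _ }

theorem homotopic_act {n : ℕ} (f : SmoothFun n) (a b : Fin n → A.obj (.op ⦋0⦌))
    (h : ∀ i, (homotopic A).r (a i) (b i)) : (homotopic A).r (act f a) (act f b) := by
  choose s h1 h0 using h
  refine ⟨act f s, ?_, ?_⟩
  · refine ((A.δ 1 : Hom _ _).map_act _ _).trans (congrArg _ (funext h1))
  · refine ((A.δ 0 : Hom _ _).map_act _ _).trans (congrArg _ (funext h0))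

/-- The set `π₀(A)`. -/
def Pi0 : Type u := Quotient (homotopic A)

/-- The class in `π₀(A)` of an element of `A₀`. -/
def Pi0.mk (a : A.obj (.op ⦋0⦌)) : Pi0 A := Quotient.mk (homotopic A) a

/-- The action on `π₀(A)` through representatives. -/
noncomputable def Pi0.act {n : ℕ} (f : SmoothFun n) (x : Fin n → Pi0 A) : Pi0 A :=
  Pi0.mk A (CInfRing.act f fun i => Quotient.out (x i))

theorem Pi0.act_mk {n : ℕ} (f : SmoothFun n) (a : Fin n → A.obj (.op ⦋0⦌)) :
    Pi0.act A f (fun i => Pi0.mk A (a i)) = Pi0.mk A (CInfRing.act f a) :=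
  Quotient.sound (homotopic_act A f _ _ fun i => Quotient.mk_out (s := homotopic A) (a i))

theorem Pi0.exists_rep {n : ℕ} (x : Fin n → Pi0 A) : 
    ∃ a : Fin n → A.obj (.op ⦋0⦌), (fun i => Pi0.mk A (a i)) = x :=
  ⟨fun i => Quotient.out (x i), funext fun i => Quotient.out_eq (x i)⟩

noncomputable instance : CInfRing (Pi0 A) where
  act := Pi0.act A
  act_proj i x := by
    obtain ⟨a, rfl⟩ := Pi0.exists_rep A x
    rw [Pi0.act_mk, act_proj]
  act_comp f g x := by
    obtain ⟨a, rfl⟩ := Pi0.exists_rep A x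
    simp only [Pi0.act_mk, act_comp]

variable {A} in
/-- The map on `π₀` induced by a morphism of simplicial `C^∞`-rings. -/
noncomputable def Pi0.map {B : SimplicialObject CInfRingCat.{u}} (φ : A ⟶ B) :
    Hom (Pi0 A) (Pi0 B) where
  toFun := Quotient.lift (fun a => Pi0.mk B (φ.app (.op ⦋0⦌) a)) (by
    rintro _ _ ⟨s, rfl, rfl⟩
    refine Quotient.sound ⟨φ.app (.op ⦋1⦌) s, ?_, ?_⟩
    · exact (ConcreteCategory.congr_hom (φ.naturality (SimplexCategory.δ 1).op) s).symm
    · exact (ConcreteCategory.congr_hom (φ.naturality (SimplexCategory.δ 0).op) s).symm)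
  map_act f x := by
    obtain ⟨a, rfl⟩ := Pi0.exists_rep A x
    refine (congrArg _ (Pi0.act_mk A f a)).trans ?_
    refine Eq.trans ?_ (Pi0.act_mk B f _).symm
    exact congrArg (Pi0.mk B) ((φ.app (.op ⦋0⦌) : Hom _ _).map_act f a)

/-- The functor `π₀` from simplicial `C^∞`-rings to `C^∞`-rings: `π₀(A)` is the quotient of
`A₀` by the congruence defined by the two face maps `A₁ → A₀`. -/
noncomputable def pi0 : SimplicialObject CInfRingCat.{u} ⥤ CInfRingCat.{u} where
  obj A := ⟨Pi0 A⟩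
  map φ := Pi0.map φ
  map_id A := by
    apply Hom.ext; funext x
    induction x using Quotient.ind
    rfl
  map_comp φ ψ := by
    apply Hom.ext; funext x
    induction x using Quotient.ind
    rfl

end SimplicialCInfRing

/-! ## Sheaves of C^∞-rings -/

namespace CInfSheaf

open CInfRing TopCat

variable {X : TopCat.{u}}

/-- The underlying presheaf of sets of a presheaf of `C^∞`-rings. -/
abbrev toSets (F : X.Presheaf CInfRingCat.{u}) : X.Presheaf (Type u) := F ⋙ forget CInfRingCat

/-- A presheaf of `C^∞`-rings is a sheaf if its underlying presheaf of sets is one. -/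
def IsSheaf (F : X.Presheaf CInfRingCat.{u}) : Prop := (toSets F).IsSheaf

/-- The stalk of a presheaf of `C^∞`-rings at a point (as a set, the colimit of the sections
over the open neighbourhoods). -/
def Stalk (F : X.Presheaf CInfRingCat.{u}) (x : X) : Type u := (toSets F).stalk x

/-- The germ at `x` of a section over an open neighbourhood `U` of `x`. -/
noncomputable def germ (F : X.Presheaf CInfRingCat.{u}) (U : Opens X) (x : X) (hx : x ∈ U)
    (s : F.obj (.op U)) : Stalk F x :=
  (toSets F).germ U x hx s

section StalkStructure

variable (F : X.Presheaf CInfRingCat.{u})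

theorem germ_res {U V : Opens X} (i : U ⟶ V) (x : X) (hx : x ∈ U) (s : F.obj (.op V)) :
    germ F U x hx (F.map i.op s) = germ F V x (i.le hx) s :=
  (toSets F).germ_res_apply i x hx s

theorem germ_eq {U V : Opens X} (x : X) (hU : x ∈ U) (hV : x ∈ V) (s : F.obj (.op U))
    (t : F.obj (.op V)) (h : germ F U x hU s = germ F V x hV t) :
    ∃ (W : Opens X) (_ : x ∈ W) (iU : W ⟶ U) (iV : W ⟶ V), F.map iU.op s = F.map iV.op t :=
  (toSets F).germ_eq x hU hV s t h

theorem res_act {n : ℕ} {U V : Opens X} (i : U ⟶ V) (f : SmoothFun n)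
    (s : Fin n → F.obj (.op V)) :
    F.map i.op (act f s) = act f (fun j => F.map i.op (s j)) :=
  CInfRing.Hom.map_act (F.map i.op) f s

/-- Finitely many germs at `x` are germs of sections over a common neighbourhood. -/
theorem exists_rep {n : ℕ} (x : X) (a : Fin n → Stalk F x) :
    ∃ (U : Opens X) (hx : x ∈ U) (s : Fin n → F.obj (.op U)),
      (fun i => germ F U x hx (s i)) = a := by
  choose U hU s hs using fun i => (toSets F).exists_germ_eq (a i)
  let W : Opens X := ⟨⋂ i, (U i : Set X), isOpen_iInter_of_finite fun i => (U i).2⟩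
  have hW : x ∈ W := Set.mem_iInter.2 hU
  have hle : ∀ i, W ≤ U i := fun i => Set.iInter_subset (fun i => (U i : Set X)) i
  refine ⟨W, hW, fun i => F.map (homOfLE (hle i)).op (s i), funext fun i => ?_⟩
  exact (germ_res F _ x hW (s i)).trans (hs i)

/-- If finitely many pairs of germs agree, then so do their images under an operation. -/
theorem germ_act_congr {n : ℕ} (f : SmoothFun n) (x : X) {U V : Opens X} (hU : x ∈ U)
    (hV : x ∈ V) (s : Fin n → F.obj (.op U)) (t : Fin n → F.obj (.op V))
    (h : ∀ i, germ F U x hU (s i) = germ F V x hV (t i)) :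
    germ F U x hU (act f s) = germ F V x hV (act f t) := by
  choose W hW iU iV e using fun i => germ_eq F x hU hV (s i) (t i) (h i)
  let W' : Opens X :=
    ⟨(U ⊓ V : Opens X) ∩ ⋂ i, (W i : Set X),
      (U ⊓ V).2.inter (isOpen_iInter_of_finite fun i => (W i).2)⟩
  have hW' : x ∈ W' := ⟨⟨hU, hV⟩, Set.mem_iInter.2 hW⟩
  have hle : ∀ i, W' ≤ W i := fun i _ hy => Set.mem_iInter.1 hy.2 i
  let jU : W' ⟶ U := homOfLE fun _ hy => hy.1.1
  let jV : W' ⟶ V := homOfLE fun _ hy => hy.1.2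
  rw [← germ_res F jU x hW', ← germ_res F jV x hW', res_act, res_act]
  congr 2
  funext i
  have h1 : jU.op = (iU i).op ≫ (homOfLE (hle i)).op := rfl
  have h2 : jV.op = (iV i).op ≫ (homOfLE (hle i)).op := rfl
  rw [h1, h2, F.map_comp, F.map_comp, ConcreteCategory.comp_apply, ConcreteCategory.comp_apply,
    e i]

/-- The action on a stalk, through sections over a common neighbourhood. -/
noncomputable def stalkAct (x : X) {n : ℕ} (f : SmoothFun n) (a : Fin n → Stalk F x) :
    Stalk F x :=
  germ F (exists_rep F x a).choose x (exists_rep F x a).choose_spec.choose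
    (act f (exists_rep F x a).choose_spec.choose_spec.choose)

theorem stalkAct_germ (x : X) {n : ℕ} (f : SmoothFun n) (U : Opens X) (hx : x ∈ U)
    (s : Fin n → F.obj (.op U)) :
    stalkAct F x f (fun i => germ F U x hx (s i)) = germ F U x hx (act f s) :=
  germ_act_congr F f x _ _ _ _
    (congrFun (exists_rep F x fun i => germ F U x hx (s i)).choose_spec.choose_spec.choose_spec)

noncomputable instance (x : X) : CInfRing (Stalk F x) where
  act := stalkAct F x
  act_proj i a := by
    obtain ⟨U, hx, s, rfl⟩ := exists_rep F x a
    rw [stalkAct_germ, act_proj]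
  act_comp f g a := by
    obtain ⟨U, hx, s, rfl⟩ := exists_rep F x a
    simp only [stalkAct_germ, act_comp]

theorem germ_act (x : X) {n : ℕ} (f : SmoothFun n) (U : Opens X) (hx : x ∈ U)
    (s : Fin n → F.obj (.op U)) :
    germ F U x hx (act f s) = act f (fun i => germ F U x hx (s i)) :=
  (stalkAct_germ F x f U hx s).symm

end StalkStructure

section Sheafification

variable (F : X.Presheaf CInfRingCat.{u})

/-- A family of germs over a subset `S` of `X` is a section of `F` over `S` if near every point
of `S` it is given by a section of `F` over an open set, i.e. if it is a continuous section over
`S` of the étale space of `F`. -/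
def IsSection (S : Set X) (s : ∀ x : S, Stalk F x) : Prop :=
  ∀ x : S, ∃ (U : Opens X) (_ : (x : X) ∈ U) (t : F.obj (.op U)),
    ∀ (y : S) (hy : (y : X) ∈ U), germ F U y hy t = s y

/-- The sections over an open set `U` of the sheaf associated to `F`. -/
def SheafifySections (U : Opens X) : Type u :=
  {s : ∀ x : (U : Set X), Stalk F x // IsSection F U s}

/-- Smooth functions act on sections germ by germ. -/
noncomputable instance (U : Opens X) : CInfRing (SheafifySections F U) where
  act {n} f s := ⟨fun x => act f (fun i => (s i).1 x), fun x => by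
    choose V hV t ht using fun i => (s i).2 x
    let W : Opens X := ⟨⋂ i, (V i : Set X), isOpen_iInter_of_finite fun i => (V i).2⟩
    have hle : ∀ i, W ≤ V i := fun i => Set.iInter_subset (fun i => (V i : Set X)) i
    refine ⟨W, Set.mem_iInter.2 hV, act f (fun i => F.map (homOfLE (hle i)).op (t i)), ?_⟩
    intro y hy
    rw [germ_act]
    congr 1
    funext i
    rw [germ_res]
    exact ht i y (hle i hy)⟩
  act_proj i s := Subtype.ext (funext fun x => act_proj i _)
  act_comp f g s := Subtype.ext (funext fun x => act_comp f g _)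

/-- The sheaf of `C^∞`-rings associated to a presheaf of `C^∞`-rings. -/
noncomputable def sheafify : X.Presheaf CInfRingCat.{u} where
  obj U := ⟨SheafifySections F U.unop⟩
  map {U V} i :=
    { toFun := fun s => ⟨fun x => s.1 ⟨x.1, i.unop.le x.2⟩, fun x => by
        obtain ⟨W, hW, t, ht⟩ := s.2 ⟨x.1, i.unop.le x.2⟩
        exact ⟨W, hW, t, fun y hy => ht ⟨y.1, i.unop.le y.2⟩ hy⟩⟩
      map_act := fun _ _ => rfl }
  map_id _ := rfl
  map_comp _ _ := rfl

/-- A presheaf `F` (in practice a sheaf) is soft if every section of `F` over a closed subset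
of `X` is the restriction of a global section. -/
def IsSoft : Prop :=
  ∀ (S : Set X), IsClosed S → ∀ s : (∀ x : S, Stalk F x), IsSection F S s →
    ∃ t : F.obj (.op ⊤), ∀ x : S, germ F ⊤ x trivial t = s x

end Sheafification

end CInfSheaf

/-! ## C^∞-spaces and simplicial C^∞-spaces -/

open CInfSheaf

/-- `(X, F)` is a `C^∞`-space. -/
structure IsCInfSpace (X : TopCat.{u}) (F : X.Presheaf CInfRingCat.{u}) : Prop where
  hausdorff : T2Space X
  isSheaf : IsSheaf F
  soft : IsSoft F
  finitelyGenerated : ∀ U : Opens X, CInfRing.FinitelyGenerated (F.obj (.op U))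
  local_stalk : ∀ x : X, CInfRing.IsLocal (Stalk F x)

/-- The degree `k` part of a presheaf of simplicial `C^∞`-rings. -/
def level {X : TopCat.{u}} (O : X.Presheaf (SimplicialObject CInfRingCat.{u})) (k : ℕ) :
    X.Presheaf CInfRingCat.{u} :=
  O ⋙ (evaluation SimplexCategoryᵒᵖ CInfRingCat.{u}).obj (.op ⦋k⦌)

/-- The sheaf associated to the presheaf `U ↦ π₀(O(U))`. -/
noncomputable def sheafPi0 {X : TopCat.{u}} (O : X.Presheaf (SimplicialObject CInfRingCat.{u})) :
    X.Presheaf CInfRingCat.{u} :=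
  sheafify (O ⋙ SimplicialCInfRing.pi0)

/-- `(X, O)` is a simplicial `C^∞`-space: `O` is a sheaf of simplicial `C^∞`-rings on `X`
and `(X, π₀(O))` is a `C^∞`-space. -/
structure IsSimplicialCInfSpace (X : TopCat.{u})
    (O : X.Presheaf (SimplicialObject CInfRingCat.{u})) : Prop where
  isSheaf : ∀ k : ℕ, IsSheaf (level O k)
  pi0 : IsCInfSpace X (sheafPi0 O)

/-- `(X, O)` is a localized simplicial `C^∞`-space: moreover the stalks of `O₀` are local. -/
structure IsLocalizedSimplicialCInfSpace (X : TopCat.{u})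
    (O : X.Presheaf (SimplicialObject CInfRingCat.{u})) : Prop
    extends IsSimplicialCInfSpace X O where
  local_stalk : ∀ x : X, CInfRing.IsLocal (Stalk (level O 0) x)

/-! Softness of `π₀` makes `X` look like a subspace of some `ℝⁿ`, and smooth cutoff functions on
`ℝⁿ` can be transported to the degree zero sheaf. Generators of the global sections of `π₀` have
real values at each point, giving a map `Φ : X → ℝⁿ`. Softness separates points from closed sets by
global sections, all of which are smooth functions of the generators, so `Φ` is inducing
(`isInducing_generators`).

Each generator lifts to degree zero near every point, since `π₀` is locally a quotient of degree
zero. A local `C^∞`-ring has only one point, so the lifts take the coordinates of `Φ` as values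
(`DetectsUnits.eq`). Applying a smooth `ρ` to the lifts gives a section whose germ at `q` depends
only on the germ of `ρ` at `Φ q` (`act_eq_of_eventuallyEq`). It is therefore exactly `0` or `1`
where `ρ` is locally so: a cutoff, although only over a neighbourhood of the chosen point.

Local cutoffs suffice. Countably many charts cover the image of `Φ`; a section given on a closed set
is extended over one chart at a time by interpolating with a local extension
(`exists_extension_chart`), and the germ at each point eventually stops changing
(`exists_extension_seq`). -/

namespace CInfRing

/-! ### Real points of local `C^∞`-rings -/

variable {A : Type u} [CInfRing A]

/-- A real-valued map on a `C^∞`-ring that commutes with all smooth operations. -/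
def IsPoint (v : A → ℝ) : Prop :=
  ∀ {n : ℕ} (f : SmoothFun n) (a : Fin n → A), v (act f a) = f.1 (fun i => v (a i))

/-- Every element at which `v` does not vanish is invertible. -/
def DetectsUnits (v : A → ℝ) : Prop :=
  ∀ a : A, v a ≠ 0 → ∃ b, mulOp a b = constOp A 1

theorem IsPoint.map_mulOp {v : A → ℝ} (hv : IsPoint v) (a b : A) :
    v (mulOp a b) = v a * v b := by
  rw [mulOp, hv]
  simp [SmoothFun.mul, SmoothFun.proj]

theorem IsPoint.map_constOp {v : A → ℝ} (hv : IsPoint v) (r : ℝ) : v (constOp A r) = r := by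
  rw [constOp, hv]
  simp [SmoothFun.const]

/-- With `s` everything, `h` vanishes only at the tuple of values of `a`. As `v` is not yet known to
commute with smooth operations, `h` is assembled from sums and products alone. -/
theorem exists_sum_sq_sub {n : ℕ} (v : A → ℝ) (hadd : ∀ a b, v (addOp a b) = v a + v b)
    (hmul : ∀ a b, v (mulOp a b) = v a * v b) (hconst : ∀ r, v (constOp A r) = r)
    (a : Fin n → A) (s : Finset (Fin n)) :
    ∃ h : SmoothFun n, (∀ x, h.1 x = ∑ i ∈ s, (x i - v (a i)) ^ 2) ∧ v (act h a) = 0 := by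
  classical
  induction s using Finset.induction_on with
  | empty => exact ⟨SmoothFun.const n 0, fun x => by simp [SmoothFun.const], by
      rw [← constOp_eq, hconst]⟩
  | insert i s hi ih =>
    obtain ⟨h, hh, h0⟩ := ih
    let d : SmoothFun n := (SmoothFun.proj i).add (SmoothFun.const n (-v (a i)))
    refine ⟨(d.mul d).add h, fun x => ?_, ?_⟩
    · rw [Finset.sum_insert hi, ← hh]
      simp only [SmoothFun.add, SmoothFun.mul, SmoothFun.proj, SmoothFun.const, d]
      ring
    · have hd : v (act d a) = 0 := by
        rw [← addOp_act, hadd, act_proj, ← constOp_eq, hconst]; ring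
      rw [← addOp_act, hadd, ← mulOp_act, hmul, hd, h0]; ring

/-- A real-valued ring homomorphism fixing the constants commutes with all smooth operations. -/
theorem isPoint_of_ringHom (v : A → ℝ) (hadd : ∀ a b, v (addOp a b) = v a + v b)
    (hmul : ∀ a b, v (mulOp a b) = v a * v b) (hconst : ∀ r, v (constOp A r) = r) :
    IsPoint v := by
  intro n f a
  by_contra hne
  obtain ⟨h, hh, h0⟩ := exists_sum_sq_sub v hadd hmul hconst a Finset.univ
  let d : SmoothFun n := f.add (SmoothFun.const n (-v (act f a)))
  -- A zero of `k` would be the tuple of values of `a`, with `f` there equal to `v (act f a)`,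
  -- against `hne`. So `1 / k` is smooth and `v (act k a)` is invertible, while additivity and
  -- multiplicativity give `v (act k a) = 0`.
  let k : SmoothFun n := (d.mul d).add h
  have hk : ∀ x, k.1 x ≠ 0 := by
    intro x hx
    have hx' : (f.1 x + -v (act f a)) * (f.1 x + -v (act f a)) +
        ∑ i, (x i - v (a i)) ^ 2 = 0 := by
      rw [← hh]; exact hx
    have h1 : 0 ≤ ∑ i, (x i - v (a i)) ^ 2 := Finset.sum_nonneg fun i _ => sq_nonneg _
    have h2 := mul_self_nonneg (f.1 x + -v (act f a))
    have h3 : ∑ i, (x i - v (a i)) ^ 2 = 0 := by linarith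
    have h4 : f.1 x + -v (act f a) = 0 := mul_self_eq_zero.1 (by linarith)
    have h5 : x = fun i => v (a i) := by
      funext i
      have := (Finset.sum_eq_zero_iff_of_nonneg fun i _ => sq_nonneg _).1 h3 i (Finset.mem_univ i)
      have := pow_eq_zero_iff (two_ne_zero) |>.1 this
      linarith
    apply hne
    rw [← h5]; linarith
  let k' : SmoothFun n := ⟨fun x => (k.1 x)⁻¹, k.2.inv hk⟩
  have hkk : k.mul k' = SmoothFun.const n 1 :=
    Subtype.ext (funext fun x => mul_inv_cancel₀ (hk x))
  have h1 : v (act k a) * v (act k' a) = 1 := by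
    rw [← hmul, mulOp_act, hkk, ← constOp_eq, hconst]
  have hd : v (act d a) = 0 := by
    rw [← addOp_act, hadd, ← constOp_eq, hconst]; ring
  have hk0 : v (act k a) = 0 := by
    rw [← addOp_act, hadd, ← mulOp_act, hmul, hd, h0]; ring
  rw [hk0, zero_mul] at h1
  exact zero_ne_one h1

/-- The point is the residue map `A → A / m ≅ ℝ`. A non-unit lies in a maximal ideal, hence in `m`,
so it has value `0`. -/
theorem IsLocal.exists_point (hA : IsLocal A) :
    ∃ v : A → ℝ, IsPoint v ∧ DetectsUnits v := by
  let _ := commRing A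
  let _ := algebra A
  obtain ⟨m, hm, ⟨e⟩⟩ := hA
  let φ : A →ₐ[ℝ] ℝ := e.toAlgHom.comp (Ideal.Quotient.mkₐ ℝ m)
  refine ⟨φ, isPoint_of_ringHom φ (map_add φ) (map_mul φ) (fun r => φ.commutes r), ?_⟩
  intro a ha
  have hu : IsUnit a := by
    by_contra hu
    obtain ⟨m', hm', ham⟩ := exists_max_ideal_of_mem_nonunits hu
    obtain rfl := (hm m').1 hm'
    apply ha
    change e (Ideal.Quotient.mk m' a) = 0
    rw [Ideal.Quotient.eq_zero_iff_mem.2 ham, map_zero]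
  exact hu.exists_right_inv

/-- The values of a point that detects units determine those of every other point. -/
theorem DetectsUnits.eq {v w : A → ℝ} (hw : DetectsUnits w) (hwp : IsPoint w) (hv : IsPoint v) :
    v = w := by
  funext a
  by_contra hne
  -- The element `a - v a` is killed by `v`. If `w a ≠ v a`, it is invertible, and applying `v` to
  -- the inverse relation gives `0 = 1`.
  let d : SmoothFun 1 := (SmoothFun.proj 0).add (SmoothFun.const 1 (-v a))
  have h1 : w (act d ![a]) ≠ 0 := by
    rw [hwp]
    simpa [d, SmoothFun.add, SmoothFun.proj, SmoothFun.const, ← sub_eq_add_neg, sub_eq_zero]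
      using Ne.symm hne
  obtain ⟨b, hb⟩ := hw _ h1
  have h2 := congrArg v hb
  rw [hv.map_mulOp, hv.map_constOp, hv] at h2
  simp [d, SmoothFun.add, SmoothFun.proj, SmoothFun.const] at h2

theorem mulOp_left_cancel {a b c d : A} (hab : mulOp a b = constOp A 1)
    (h : mulOp a c = mulOp a d) : c = d := by
  let _ := commRing A
  have hab' : a * b = 1 := hab
  have h' : a * c = a * d := h
  calc c = (a * b) * c := by rw [hab', one_mul]
    _ = b * (a * c) := by ring
    _ = b * (a * d) := by rw [h']
    _ = (a * b) * d := by ring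
    _ = d := by rw [hab', one_mul]

/-- In a local `C^∞`-ring, the operation of a smooth function depends only on its germ at the
point determined by the arguments. -/
theorem act_eq_of_eventuallyEq {v : A → ℝ} (hv : IsPoint v) (hu : DetectsUnits v) {n : ℕ}
    (f g : SmoothFun n) (a : Fin n → A)
    (hfg : ∀ᶠ x in nhds (fun i => v (a i)), f.1 x = g.1 x) : act f a = act g a := by
  -- A bump function supported where `f = g` and equal to `1` at the point: `ψ f = ψ g` holds
  -- everywhere, and `ψ` acts on `a` as a unit, which can be cancelled.
  obtain ⟨ψ, hs, -, hψ, -, h1⟩ :=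
    exists_contDiff_tsupport_subset (n := (⊤ : ℕ∞)) (E := Fin n → ℝ) hfg
  let p : SmoothFun n := ⟨ψ, hψ⟩
  have hp : v (act p a) ≠ 0 := by
    rw [hv]; simp only [p, h1]; exact one_ne_zero
  obtain ⟨b, hb⟩ := hu _ hp
  refine mulOp_left_cancel hb ?_
  rw [mulOp_act, mulOp_act]
  congr 1
  apply Subtype.ext; funext x
  by_cases hx : x ∈ tsupport ψ
  · exact congrArg (ψ x * ·) (hs hx)
  · simp [SmoothFun.mul, p, image_eq_zero_of_notMem_tsupport hx]

/-! ### Interpolation between two elements -/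

/-- The function `r * s + (1 - r) * t` of three variables. -/
def blend : SmoothFun 3 :=
  ((SmoothFun.proj 0).mul (SmoothFun.proj 1)).add
    (((SmoothFun.const 3 1).add (SmoothFun.proj 0).neg).mul (SmoothFun.proj 2))

theorem act_blend (r s t : A) : act blend ![r, s, t] =
    addOp (mulOp r s) (mulOp (addOp (constOp A 1) (negOp r)) t) := by
  rw [blend, ← addOp_act, ← mulOp_act, ← mulOp_act, ← addOp_act, ← negOp_act, ← constOp_eq]
  simp only [act_proj]
  rfl

theorem act_blend_one (s t : A) : act blend ![constOp A 1, s, t] = s := by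
  rw [act_blend]
  let _ := commRing A
  change (1 : A) * s + (1 + -1) * t = s
  ring

theorem act_blend_zero (s t : A) : act blend ![constOp A 0, s, t] = t := by
  rw [act_blend]
  let _ := commRing A
  change (0 : A) * s + (1 + -0) * t = t
  ring

/-- Keeps an interpolated section equal to the prescribed one where the cutoff is neither `0` nor
`1`, since both inputs already have the right germ there. -/
theorem act_blend_self (r s : A) : act blend ![r, s, s] = s := by
  rw [act_blend]
  let _ := commRing A
  change r * s + (1 + -r) * s = s
  ring

end CInfRing

/-! ### Families of germs and gluing -/

namespace CInfSheaf

open CInfRing TopCat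

variable {X : TopCat.{u}} (F : X.Presheaf CInfRingCat.{u})

/-- Near `q`, the family of germs `s` is given by a section of `F`. -/
def IsLocalAt (s : ∀ q : X, Stalk F q) (q : X) : Prop :=
  ∃ (U : Opens X) (_ : q ∈ U) (t : F.obj (.op U)), ∀ (y : X) (hy : y ∈ U), germ F U y hy t = s y

variable {F}

theorem IsLocalAt.congr {s s' : ∀ q : X, Stalk F q} {q : X} (h : IsLocalAt F s q) {V : Set X}
    (hV : IsOpen V) (hq : q ∈ V) (e : ∀ y ∈ V, s y = s' y) : IsLocalAt F s' q := by
  obtain ⟨U, hU, t, ht⟩ := h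
  let W : Opens X := U ⊓ ⟨V, hV⟩
  refine ⟨W, ⟨hU, hq⟩, F.map (homOfLE (inf_le_left : W ≤ U)).op t, fun y hy => ?_⟩
  rw [germ_res, ht, e y hy.2]

theorem IsLocalAt.act {n : ℕ} {s : Fin n → ∀ q : X, Stalk F q} {q : X}
    (h : ∀ i, IsLocalAt F (s i) q) (f : SmoothFun n) :
    IsLocalAt F (fun y => CInfRing.act f (fun i => s i y)) q := by
  choose V hV t ht using h
  let W : Opens X := ⟨⋂ i, (V i : Set X), isOpen_iInter_of_finite fun i => (V i).2⟩
  have hle : ∀ i, W ≤ V i := fun i => Set.iInter_subset (fun i => (V i : Set X)) i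
  refine ⟨W, Set.mem_iInter.2 hV, CInfRing.act f (fun i => F.map (homOfLE (hle i)).op (t i)),
    fun y hy => ?_⟩
  rw [germ_act]
  congr 1
  funext i
  rw [germ_res]
  exact ht i y (hle i hy)

theorem germ_constOp (U : Opens X) (x : X) (hx : x ∈ U) (r : ℝ) :
    germ F U x hx (constOp _ r) = constOp _ r := by
  rw [constOp, germ_act, ← constOp_eq]

theorem isLocalAt_constOp (r : ℝ) (q : X) :
    IsLocalAt F (fun y => constOp (Stalk F y) r) q :=
  ⟨⊤, trivial, constOp _ r, fun y hy => germ_constOp ⊤ y hy r⟩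

open Classical in
/-- The germs of a section over an open set, extended by zero. -/
noncomputable def germOrZero {U : Opens X} (t : F.obj (.op U)) (q : X) : Stalk F q :=
  if hq : q ∈ U then germ F U q hq t else constOp _ 0

theorem germOrZero_of_mem {U : Opens X} (t : F.obj (.op U)) {q : X} (hq : q ∈ U) :
    germOrZero t q = germ F U q hq t := dif_pos hq

theorem isLocalAt_germOrZero {U : Opens X} (t : F.obj (.op U)) {q : X} (hq : q ∈ U) :
    IsLocalAt F (germOrZero t) q :=
  ⟨U, hq, t, fun _ hy => (germOrZero_of_mem t hy).symm⟩

/-- A family of germs that is everywhere locally given by sections of a sheaf comes from a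
global section. -/
theorem exists_global_section (hF : IsSheaf F) (s : ∀ q : X, Stalk F q)
    (hs : ∀ q, IsLocalAt F s q) :
    ∃ t : F.obj (.op ⊤), ∀ x : X, germ F ⊤ x trivial t = s x := by
  choose U hU t ht using hs
  let G : TopCat.Sheaf (Type u) X := ⟨toSets F, hF⟩
  have hcompat : Presheaf.IsCompatible G.1 U t := by
    intro p q
    refine Presheaf.section_ext G (U p ⊓ U q) _ _ fun x hx => ?_
    refine (germ_res F (Opens.infLELeft (U p) (U q)) x hx (t p)).trans ?_
    refine Eq.trans ?_ (germ_res F (Opens.infLERight (U p) (U q)) x hx (t q)).symm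
    rw [ht, ht]
  obtain ⟨g, hg, -⟩ := G.existsUnique_gluing' U ⊤ (fun p => homOfLE le_top)
    (fun x _ => Opens.mem_iSup.2 ⟨x, hU x⟩) t hcompat
  refine ⟨g, fun x => ?_⟩
  rw [← ht x x (hU x), ← hg x]
  exact (germ_res F (homOfLE le_top) x (hU x) g).symm

/-! ### Extension of sections by means of cutoffs -/

variable (F) in
/-- Every smooth function on `ℝⁿ` has a counterpart among the sections of `F` over the preimage
of `G` under `Φ`, which is `0` or `1` wherever the function is locally `0` or `1`. -/
def HasCutoffs {n : ℕ} (Φ : X → Fin n → ℝ) (G : Set (Fin n → ℝ)) : Prop :=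
  ∀ ρ : SmoothFun n, ∃ r : ∀ q : X, Stalk F q, ∀ q, Φ q ∈ G → IsLocalAt F r q ∧
    ((∀ᶠ z in nhds (Φ q), ρ.1 z = 0) → r q = constOp _ 0) ∧
    ((∀ᶠ z in nhds (Φ q), ρ.1 z = 1) → r q = constOp _ 1)

/-- The values `0` and `1` are taken on neighbourhoods, not just pointwise, because `HasCutoffs`
controls a germ only where `ρ` is locally constant. -/
theorem exists_smoothFun_zero_one {n : ℕ} {D W : Set (Fin n → ℝ)} (hD : IsClosed D)
    (hW : IsOpen W) (hDW : D ⊆ W) :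
    ∃ ρ : SmoothFun n, (∀ z ∉ W, ∀ᶠ y in nhds z, ρ.1 y = 0) ∧
      ∀ z ∈ D, ∀ᶠ y in nhds z, ρ.1 y = 1 := by
  obtain ⟨f, h0, h1, -⟩ := exists_contMDiffMap_zero_one_nhds_of_isClosed
    (modelWithCornersSelf ℝ (Fin n → ℝ)) (n := (⊤ : ℕ∞)) hW.isClosed_compl hD
    (Set.disjoint_left.2 fun z hz hz' => hz (hDW hz'))
  exact ⟨⟨f, f.contMDiff.contDiff⟩, fun z hz => eventually_nhdsSet_iff_forall.1 h0 z hz,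
    fun z hz => eventually_nhdsSet_iff_forall.1 h1 z hz⟩

/-- Extending a section from a neighbourhood of a closed set over one more chart. -/
theorem exists_extension_chart {n : ℕ} {Φ : X → Fin n → ℝ} (hΦ : Continuous Φ)
    {D W G : Set (Fin n → ℝ)} (hD : IsClosed D) (hW : IsOpen W) (hDW : D ⊆ W) (hG : IsOpen G)
    (hcut : HasCutoffs F Φ G) {S : Set X} (σ : ∀ x : S, Stalk F x) {s t : ∀ q : X, Stalk F q}
    (hs : ∀ q, Φ q ∈ W → IsLocalAt F s q) (ht : ∀ q, Φ q ∈ G → IsLocalAt F t q)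
    (hsσ : ∀ q : S, Φ q ∈ W → s q = σ q) (htσ : ∀ q : S, Φ q ∈ G → t q = σ q) :
    ∃ (W' : Set (Fin n → ℝ)) (s' : ∀ q : X, Stalk F q), IsOpen W' ∧ D ⊆ W' ∧ G ⊆ W' ∧
      (∀ q, Φ q ∈ W' → IsLocalAt F s' q) ∧ (∀ q : S, Φ q ∈ W' → s' q = σ q) ∧
      ∀ q, Φ q ∈ D → s' q = s q := by
  classical
  obtain ⟨ρ, h0, h1⟩ := exists_smoothFun_zero_one hD hW hDW
  obtain ⟨r, hr⟩ := hcut ρ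
  let V : Set (Fin n → ℝ) := {z | ∀ᶠ y in nhds z, ρ.1 y = 1}
  have hV : IsOpen V := isOpen_setOfPred_eventually_nhds
  let Z : Set (Fin n → ℝ) := {z | ∀ᶠ y in nhds z, ρ.1 y = 0}
  have hZ : IsOpen Z := isOpen_setOfPred_eventually_nhds
  have hVW : V ⊆ W := by
    intro z hz
    by_contra hzW
    have e1 : ρ.1 z = 1 := hz.self_of_nhds
    have e0 : ρ.1 z = 0 := (h0 z hzW).self_of_nhds
    exact one_ne_zero (e1.symm.trans e0)
  let b : ∀ q : X, Stalk F q := fun q => act blend (fun i => (![r q, s q, t q] : Fin 3 → _) i)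
  -- The cutoff `r` is only controlled over `G`. Leaving `s` unchanged off `G` causes no jump over
  -- `V`, where the interpolation already equals `s`.
  let s' : ∀ q : X, Stalk F q := fun q => if Φ q ∈ G then b q else s q
  have hs'G : ∀ q, Φ q ∈ G → s' q = b q := fun q hq => if_pos hq
  have hs'V : ∀ q, Φ q ∈ V → s' q = s q := by
    intro q hq
    by_cases hqG : Φ q ∈ G
    · rw [hs'G q hqG]
      change act blend ![r q, s q, t q] = _
      rw [(hr q hqG).2.2 hq, act_blend_one]
    · exact if_neg hqG
  have hs'Z : ∀ q, Φ q ∈ G → Φ q ∈ Z → s' q = t q := by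
    intro q hqG hq
    rw [hs'G q hqG]
    change act blend ![r q, s q, t q] = _
    rw [(hr q hqG).2.1 hq, act_blend_zero]
  -- The new domain is not `W ∪ G`: outside `V`, the family `s'` may jump at the boundary of `G`.
  refine ⟨V ∪ G, s', hV.union hG, fun z hz => Or.inl (h1 z hz), Set.subset_union_right,
    ?_, ?_, fun q hq => hs'V q (h1 _ hq)⟩
  · rintro q (hq | hq)
    · exact (hs q (hVW hq)).congr (hV.preimage hΦ) hq fun y hy => (hs'V y hy).symm
    · by_cases hqW : Φ q ∈ W
      · have hb : IsLocalAt F b q := by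
          refine IsLocalAt.act (s := fun i y => (![r y, s y, t y] : Fin 3 → _) i) ?_ blend
          intro i
          fin_cases i
          exacts [(hr q hq).1, hs q hqW, ht q hq]
        exact hb.congr (hG.preimage hΦ) hq fun y hy => (hs'G y hy).symm
      -- Outside `W` nothing is known about `s`, but the cutoff is zero nearby, so `s'` agrees with
      -- `t` there.
      · exact (ht q hq).congr ((hG.inter hZ).preimage hΦ) ⟨hq, h0 _ hqW⟩
          fun y hy => (hs'Z y hy.1 hy.2).symm
  · rintro q (hq | hq)
    · rw [hs'V q hq, hsσ q (hVW hq)]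
    · by_cases hqW : Φ q ∈ W
      · rw [hs'G q hq]
        change act blend ![r q, s q, t q] = _
        rw [hsσ q hqW, htσ q hq, act_blend_self]
      · rw [hs'Z q hq (h0 _ hqW), htσ q hq]

/-- Extending a section over a sequence of charts. -/
theorem exists_extension_seq {n : ℕ} {Φ : X → Fin n → ℝ} (hΦ : Continuous Φ)
    (K G : ℕ → Set (Fin n → ℝ)) (hK : ∀ k, IsClosed (K k)) (hG : ∀ k, IsOpen (G k))
    (hKG : ∀ k, K k ⊆ G k) (hcov : ∀ q, ∃ k, Φ q ∈ interior (K k))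
    (hcut : ∀ k, HasCutoffs F Φ (G k)) {S : Set X} (σ : ∀ x : S, Stalk F x)
    (t : ℕ → ∀ q : X, Stalk F q) (ht : ∀ k q, Φ q ∈ G k → IsLocalAt F (t k) q)
    (htσ : ∀ k (q : S), Φ q ∈ G k → t k q = σ q) :
    ∃ s : ∀ q : X, Stalk F q, (∀ q, IsLocalAt F s q) ∧ ∀ q : S, s q = σ q := by
  let D : ℕ → Set (Fin n → ℝ) := fun k => ⋃ j ∈ Finset.range k, K j
  have hD : ∀ k, IsClosed (D k) := fun k => isClosed_biUnion_finset fun j _ => hK j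
  have hKD : ∀ {j k}, j < k → K j ⊆ D k := fun {j k} h =>
    Set.subset_biUnion_of_mem (u := K) (Finset.mem_coe.2 (Finset.mem_range.2 h))
  have hDmono : ∀ {j k}, j ≤ k → D j ⊆ D k := fun {j k} h =>
    Set.iUnion₂_subset fun i hi => hKD ((Finset.mem_range.1 hi).trans_le h)
  -- The neighbourhoods `W` need not be nested from stage to stage; only the germs over the closed
  -- set `D k` are preserved.
  let State : ℕ → Type u := fun k => {s : ∀ q : X, Stalk F q //
    ∃ W : Set (Fin n → ℝ), IsOpen W ∧ D k ⊆ W ∧ (∀ q, Φ q ∈ W → IsLocalAt F s q) ∧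
      ∀ q : S, Φ q ∈ W → s q = σ q}
  have next : ∀ k (a : State k), ∃ b : State (k + 1), ∀ q, Φ q ∈ D k → b.1 q = a.1 q := by
    rintro k ⟨s, W, hW, hDW, hs, hsσ⟩
    obtain ⟨W', s', hW', hDW', hGW', hs', hsσ', hss'⟩ := exists_extension_chart hΦ (hD k) hW hDW
      (hG k) (hcut k) σ hs (ht k) hsσ (htσ k)
    refine ⟨⟨s', W', hW', ?_, hs', hsσ'⟩, hss'⟩
    refine Set.iUnion₂_subset fun j hj => ?_
    rcases Nat.lt_succ_iff_lt_or_eq.1 (Finset.mem_range.1 hj) with h | rfl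
    · exact (hKD h).trans hDW'
    · exact (hKG j).trans hGW'
  choose nx hnx using next
  -- `D 0` is empty, so any family will do at the start, with `W = ∅`.
  let a : ∀ k, State k := fun k => Nat.rec
    ⟨fun q => constOp _ 0, ∅, isOpen_empty, by simp [D], by simp, by simp⟩ nx k
  have ha : ∀ j k, j ≤ k → ∀ q, Φ q ∈ D j → (a k).1 q = (a j).1 q := by
    intro j k hjk
    induction k, hjk using Nat.le_induction with
    | base => exact fun q _ => rfl
    | succ k hjk ih =>
      intro q hq
      exact (hnx k (a k) q (hDmono hjk hq)).trans (ih q hq)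
  choose κ hκ using hcov
  have hκD : ∀ q, Φ q ∈ D (κ q + 1) := fun q => hKD (Nat.lt_succ_self _) (interior_subset (hκ q))
  -- Since `D k` involves only indices below `k`, the set `K (κ q)` enters at stage `κ q + 1`; from
  -- then on the germ at `q` is fixed.
  let s : ∀ q : X, Stalk F q := fun q => (a (κ q + 1)).1 q
  have hs : ∀ k q, Φ q ∈ D k → s q = (a k).1 q := by
    intro k q hq
    rcases le_total k (κ q + 1) with h | h
    · exact ha _ _ h q hq
    · exact (ha _ _ h q (hκD q)).symm
  refine ⟨s, fun q => ?_, fun q => ?_⟩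
  · obtain ⟨W, -, hDW, hl, -⟩ := (a (κ q + 1)).2
    -- Covering by interiors is what lets one single stage compute `s` on a whole neighbourhood of
    -- `q`.
    refine (hl q (hDW (hκD q))).congr (isOpen_interior.preimage hΦ) (hκ q) fun y hy => ?_
    exact (hs _ y (hKD (Nat.lt_succ_self _) (interior_subset hy))).symm
  · obtain ⟨W, -, hDW, -, hσ⟩ := (a (κ (q : X) + 1)).2
    exact hσ q (hDW (hκD q))

/-- A sheaf on a subspace of `ℝⁿ` that locally has cutoff sections is soft. -/
theorem isSoft_of_hasCutoffs (hF : IsSheaf F) {n : ℕ} {Φ : X → Fin n → ℝ}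
    (hΦ : Topology.IsInducing Φ)
    (hcut : ∀ q, ∃ G : Set (Fin n → ℝ), IsOpen G ∧ Φ q ∈ G ∧ HasCutoffs F Φ G) : IsSoft F := by
  intro S hS σ hσ
  suffices h : ∃ s : ∀ q : X, Stalk F q, (∀ q, IsLocalAt F s q) ∧ ∀ q : S, s q = σ q by
    obtain ⟨s, hs, hsσ⟩ := h
    obtain ⟨t, ht⟩ := exists_global_section hF s hs
    exact ⟨t, fun x => (ht x).trans (hsσ x)⟩
  have hchart : ∀ p : X, ∃ (K G : Set (Fin n → ℝ)) (t : ∀ q : X, Stalk F q), IsClosed K ∧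
      IsOpen G ∧ K ⊆ G ∧ Φ p ∈ interior K ∧ HasCutoffs F Φ G ∧
      (∀ q, Φ q ∈ G → IsLocalAt F t q) ∧ ∀ q : S, Φ q ∈ G → t q = σ q := by
    intro p
    obtain ⟨G₁, hG₁, hpG₁, hc⟩ := hcut p
    have h2 : ∃ (G₂ : Set (Fin n → ℝ)) (t : ∀ q : X, Stalk F q), IsOpen G₂ ∧ Φ p ∈ G₂ ∧
        (∀ q, Φ q ∈ G₂ → IsLocalAt F t q) ∧ ∀ q : S, Φ q ∈ G₂ → t q = σ q := by
      by_cases hp : p ∈ S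
      · obtain ⟨U, hU, t, ht⟩ := hσ ⟨p, hp⟩
        obtain ⟨G₂, hG₂, hGU⟩ := hΦ.isOpen_iff.1 U.2
        have hmem : ∀ q, Φ q ∈ G₂ ↔ q ∈ U := fun q => Set.ext_iff.1 hGU q
        refine ⟨G₂, germOrZero t, hG₂, (hmem p).2 hU,
          fun q hq => isLocalAt_germOrZero t ((hmem q).1 hq), fun q hq => ?_⟩
        rw [germOrZero_of_mem t ((hmem q).1 hq), ht]
      -- Away from `S` the zero section serves: agreement with `σ` is vacuous on the complement of
      -- `S`.
      · obtain ⟨G₂, hG₂, hGU⟩ := hΦ.isOpen_iff.1 hS.isOpen_compl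
        have hmem : ∀ q, Φ q ∈ G₂ ↔ q ∈ Sᶜ := fun q => Set.ext_iff.1 hGU q
        exact ⟨G₂, fun q => constOp _ 0, hG₂, (hmem p).2 hp, fun q _ => isLocalAt_constOp 0 q,
          fun q hq => absurd q.2 ((hmem q).1 hq)⟩
    obtain ⟨G₂, t, hG₂, hpG₂, ht, htσ⟩ := h2
    obtain ⟨K, hKn, hK, hKG⟩ := exists_mem_nhds_isClosed_subset
      ((hG₁.inter hG₂).mem_nhds ⟨hpG₁, hpG₂⟩)
    refine ⟨K, G₁ ∩ G₂, t, hK, hG₁.inter hG₂, hKG, mem_interior_iff_mem_nhds.2 hKn, ?_,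
      fun q hq => ht q hq.2, fun q hq => htσ q hq.2⟩
    intro ρ
    obtain ⟨r, hr⟩ := hc ρ
    exact ⟨r, fun q hq => hr q hq.1⟩
  choose K G t hK hG hKG hp hc ht htσ using hchart
  -- Second countability of `ℝⁿ` reduces the charts to countably many.
  obtain ⟨T, hT, hTU⟩ := isOpen_iUnion_countable (fun p => interior (K p))
    fun p => isOpen_interior
  have hcov : ∀ q, ∃ p ∈ T, Φ q ∈ interior (K p) := by
    intro q
    have hq : Φ q ∈ ⋃ p ∈ T, interior (K p) := hTU ▸ Set.mem_iUnion.2 ⟨q, hp q⟩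
    simpa using hq
  rcases T.eq_empty_or_nonempty with rfl | hne
  · have hX : ∀ q : X, False := fun q => by simpa using hcov q
    exact ⟨fun q => (hX q).elim, fun q => (hX q).elim, fun q => (hX q).elim⟩
  · obtain ⟨e, rfl⟩ := hT.exists_eq_range hne
    refine exists_extension_seq hΦ.continuous (fun k => K (e k)) (fun k => G (e k))
      (fun k => hK _) (fun k => hG _) (fun k => hKG _) ?_ (fun k => hc _) σ
      (fun k => t (e k)) (fun k => ht _) (fun k => htσ _)
    intro q
    obtain ⟨_, ⟨k, rfl⟩, h⟩ := hcov q
    exact ⟨k, h⟩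

end CInfSheaf

/-! ### Stalk maps and the topology defined by generators -/

namespace CInfSheaf

open CInfRing TopCat

variable {X : TopCat.{u}} {F G : X.Presheaf CInfRingCat.{u}}

/-- The map induced on stalks by a morphism of presheaves of `C^∞`-rings. -/
noncomputable def stalkMap (α : F ⟶ G) (x : X) (a : Stalk F x) : Stalk G x :=
  (Presheaf.stalkFunctor (Type u) x).map (Functor.whiskerRight α (forget CInfRingCat)) a

theorem stalkMap_germ (α : F ⟶ G) (x : X) (U : Opens X) (hx : x ∈ U) (s : F.obj (.op U)) :
    stalkMap α x (germ F U x hx s) = germ G U x hx ((α.app (.op U) : CInfRing.Hom _ _) s) :=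
  Presheaf.stalkFunctor_map_germ_apply U x hx
    (Functor.whiskerRight α (forget CInfRingCat)) s

theorem stalkMap_act (α : F ⟶ G) (x : X) {n : ℕ} (f : SmoothFun n) (a : Fin n → Stalk F x) :
    stalkMap α x (act f a) = act f (fun i => stalkMap α x (a i)) := by
  obtain ⟨U, hx, s, rfl⟩ := exists_rep F x a
  simp only [← germ_act, stalkMap_germ]
  exact congrArg (germ G U x hx) ((α.app (.op U) : CInfRing.Hom _ _).map_act f s)

/-- Allows the value on a `π₀` stalk to be compared, after pullback, with the only point of the
degree zero stalk. -/
theorem isPoint_comp_stalkMap (α : F ⟶ G) (x : X) {v : Stalk G x → ℝ} (hv : IsPoint v) :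
    IsPoint (fun a => v (stalkMap α x a)) := fun f a =>
  (congrArg v (stalkMap_act α x f a)).trans (hv f _)

/-- The non-vanishing locus of a section is open. -/
theorem isOpen_ne_zero {v : ∀ q : X, Stalk F q → ℝ} (hv : ∀ q, IsPoint (v q))
    (hu : ∀ q, DetectsUnits (v q)) (s : F.obj (.op ⊤)) :
    IsOpen {q | v q (germ F ⊤ q (Opens.mem_top q) s) ≠ 0} := by
  rw [isOpen_iff_mem_nhds]
  intro q hq
  obtain ⟨b, hb⟩ := hu q _ hq
  obtain ⟨U, hU, t, ht⟩ := exists_rep F q ![b]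
  have hb' : germ F U q hU (t 0) = b := congrFun ht 0
  let s' : F.obj (.op U) := F.map (homOfLE le_top).op s
  have hs' : ∀ y (hy : y ∈ U), germ F U y hy s' = germ F ⊤ y (Opens.mem_top y) s :=
    fun y hy => germ_res F _ y hy s
  have hmul : ∀ y (hy : y ∈ U), germ F U y hy (mulOp s' (t 0)) =
      mulOp (germ F ⊤ y (Opens.mem_top y) s) (germ F U y hy (t 0)) := by
    intro y hy
    rw [← hs' y hy, mulOp, mulOp, germ_act]
    congr 1
    funext i
    fin_cases i <;> rfl
  -- The inverse relation holds for germs at `q`, hence for sections near `q`, and forces a nonzero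
  -- value at nearby points.
  have h1 : germ F U q hU (mulOp s' (t 0)) = germ F U q hU (constOp _ 1) := by
    rw [hmul, hb', hb, germ_constOp]
  obtain ⟨W, hW, i, j, e⟩ := germ_eq F q hU hU _ _ h1
  refine Filter.mem_of_superset (W.2.mem_nhds hW) fun y hy => ?_
  have h2 : germ F U y (i.le hy) (mulOp s' (t 0)) = constOp _ 1 := by
    rw [← germ_res F i y hy, e, germ_res F j y hy, germ_constOp]
  rw [hmul] at h2
  have h3 := congrArg (v y) h2
  rw [IsPoint.map_mulOp (hv y), IsPoint.map_constOp (hv y)] at h3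
  exact left_ne_zero_of_mul (h3 ▸ one_ne_zero)

/-- A soft sheaf separates points from closed sets. -/
theorem IsSoft.exists_separating [T1Space X] (hF : IsSoft F) {U : Opens X} {p : X} (hp : p ∈ U) :
    ∃ s : F.obj (.op ⊤), germ F ⊤ p (Opens.mem_top p) s = constOp _ 1 ∧
      ∀ q ∉ U, germ F ⊤ q (Opens.mem_top q) s = constOp _ 0 := by
  classical
  -- The family `1` at `p`, `0` off `U` is a section over `S`, because `p` and the complement of `U`
  -- are disjoint closed sets.
  let S : Set X := (U : Set X)ᶜ ∪ {p}
  have hS : IsClosed S := U.2.isClosed_compl.union isClosed_singleton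
  obtain ⟨s, hs⟩ := hF S hS (fun x => if (x : X) ∈ U then constOp _ 1 else constOp _ 0) (by
    intro x
    by_cases hx : (x : X) ∈ U
    · exact ⟨U, hx, constOp _ 1, fun y hy => (germ_constOp U _ hy 1).trans (if_pos hy).symm⟩
    · refine ⟨⟨{p}ᶜ, isOpen_compl_singleton⟩, ?_, constOp _ 0, fun y hy => ?_⟩
      · intro h
        exact hx ((Set.mem_singleton_iff.1 h).symm ▸ hp)
      · refine (germ_constOp _ _ hy 0).trans (if_neg ?_).symm
        rcases y.2 with h | h
        · exact h
        · exact absurd h hy)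
  exact ⟨s, by simpa [hp] using hs ⟨p, Or.inr rfl⟩,
    fun q hq => by simpa [hq] using hs ⟨q, Or.inl hq⟩⟩

/-- The generators of the ring of global sections of a `C^∞`-space identify it topologically
with a subspace of `ℝⁿ`. -/
theorem isInducing_generators [T1Space X] (hF : IsSoft F) {n : ℕ}
    (e : CInfRing.Hom (SmoothFun n) (F.obj (.op ⊤))) (he : Function.Surjective e)
    {v : ∀ q : X, Stalk F q → ℝ} (hv : ∀ q, IsPoint (v q)) (hu : ∀ q, DetectsUnits (v q)) :
    Topology.IsInducing fun (q : X) (i : Fin n) =>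
      v q (germ F ⊤ q (Opens.mem_top q) (e (SmoothFun.proj i))) := by
  set Φ : X → Fin n → ℝ := fun q i => v q (germ F ⊤ q (Opens.mem_top q) (e (SmoothFun.proj i)))
  have hval : ∀ (φ : SmoothFun n) (q : X), v q (germ F ⊤ q (Opens.mem_top q) (e φ)) = φ.1 (Φ q) := by
    intro φ q
    have h1 : e φ = act φ (fun i => e (SmoothFun.proj i)) := e.map_act φ SmoothFun.proj
    rw [h1]
    exact (congrArg (v q) (germ_act F q φ ⊤ (Opens.mem_top q) _)).trans (hv q φ _)
  have hcont : Continuous Φ := by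
    rw [continuous_def]
    intro G hG
    -- Every open set of `ℝⁿ` is the non-vanishing locus of a smooth `φ`; its preimage is the
    -- non-vanishing locus of the section `e φ`.
    obtain ⟨φ, hφ, hφs, -⟩ := hG.exists_contDiff_support_eq (n := (⊤ : ℕ∞))
    convert isOpen_ne_zero hv hu (e ⟨φ, hφs⟩) using 1
    ext q
    rw [← hφ]
    exact not_congr (Eq.congr_left (hval ⟨φ, hφs⟩ q).symm)
  rw [Topology.isInducing_iff_nhds]
  intro p
  refine le_antisymm (hcont.tendsto p).le_comap fun N hN => ?_
  obtain ⟨U, hUN, hU, hpU⟩ := mem_nhds_iff.1 hN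
  obtain ⟨s, hs1, hs0⟩ := hF.exists_separating (U := ⟨U, hU⟩) hpU
  -- Surjectivity of `e` makes the separating section a smooth function of `Φ`, so the locus `φ ≠ 0`
  -- pulls back into `N`.
  obtain ⟨φ, rfl⟩ := he s
  refine Filter.mem_comap.2 ⟨{z | φ.1 z ≠ 0}, ?_, fun q hq => ?_⟩
  · refine (isOpen_ne_fun φ.2.continuous continuous_const).mem_nhds ?_
    rw [Set.mem_ofPred_eq, ← hval, hs1, IsPoint.map_constOp (hv p)]
    exact one_ne_zero
  · by_contra hqN
    apply hq
    rw [← hval, hs0 q fun h => hqN (hUN h), IsPoint.map_constOp (hv q)]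

/-- Sections of a sheaf with local stalks whose values are the coordinates of `Φ` give rise to
cutoff sections. -/
theorem hasCutoffs_of_values {v : ∀ q : X, Stalk F q → ℝ} (hv : ∀ q, IsPoint (v q))
    (hu : ∀ q, DetectsUnits (v q)) {n : ℕ} {Φ : X → Fin n → ℝ} {G : Set (Fin n → ℝ)}
    (y : Fin n → ∀ q : X, Stalk F q) (hy : ∀ i q, Φ q ∈ G → IsLocalAt F (y i) q)
    (hval : ∀ i q, Φ q ∈ G → v q (y i q) = Φ q i) : HasCutoffs F Φ G := by
  intro ρ
  refine ⟨fun q => act ρ (fun i => y i q), fun q hq => ?_⟩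
  have h : ∀ c : ℝ, (∀ᶠ z in nhds (Φ q), ρ.1 z = c) →
      act ρ (fun i => y i q) = constOp _ c := by
    intro c hc
    rw [constOp_eq c fun i => y i q]
    -- Locality of the stalk turns equality of `ρ` with a constant near `Φ q` into equality of
    -- germs.
    refine act_eq_of_eventuallyEq (hv q) (hu q) _ _ _ ?_
    rw [show (fun i => v q (y i q)) = Φ q from funext fun i => hval i q hq]
    exact hc
  exact ⟨IsLocalAt.act (fun i => hy i q hq) ρ, h 0, h 1⟩

/-! ### Comparison of degree zero with `π₀` -/

/-- The canonical morphism from the degree zero part to the sheaf of connected components. -/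
noncomputable def toSheafPi0 (O : X.Presheaf (SimplicialObject CInfRingCat.{u})) :
    level O 0 ⟶ sheafPi0 O where
  app U :=
    { toFun := fun s => ⟨fun x => germ (O ⋙ SimplicialCInfRing.pi0) U.unop x x.2
          (SimplicialCInfRing.Pi0.mk _ s),
        fun x => ⟨U.unop, x.2, SimplicialCInfRing.Pi0.mk _ s, fun _ _ => rfl⟩⟩
      map_act := fun f a => Subtype.ext (funext fun x => by
        refine (congrArg (germ (O ⋙ SimplicialCInfRing.pi0) U.unop x x.2)
          (SimplicialCInfRing.Pi0.act_mk _ f a).symm).trans ?_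
        exact germ_act (O ⋙ SimplicialCInfRing.pi0) _ f U.unop x.2 _) }
  naturality U V i := Hom.ext (funext fun s => Subtype.ext (funext fun x =>
    germ_res (O ⋙ SimplicialCInfRing.pi0) i.unop x.1 x.2 (SimplicialCInfRing.Pi0.mk _ s)))

/-- Every global section of the sheaf of connected components lifts locally to degree zero. -/
theorem exists_local_lift (O : X.Presheaf (SimplicialObject CInfRingCat.{u}))
    (a : (sheafPi0 O).obj (.op ⊤)) (p : X) :
    ∃ (U : Opens X) (_ : p ∈ U) (s : (level O 0).obj (.op U)), ∀ q (hq : q ∈ U),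
      stalkMap (toSheafPi0 O) q (germ (level O 0) U q hq s) =
        germ (sheafPi0 O) ⊤ q (Opens.mem_top q) a := by
  -- Near `p`, a section of the associated sheaf is a single class in `π₀` of the sections over `U`,
  -- and any class has a representative in degree zero.
  obtain ⟨U, hU, τ, hτ⟩ := a.2 ⟨p, trivial⟩
  obtain ⟨s, rfl⟩ := Quotient.exists_rep τ
  refine ⟨U, hU, s, fun q hq => ?_⟩
  refine (stalkMap_germ (toSheafPi0 O) q U hq s).trans ?_
  rw [← germ_res (sheafPi0 O) (homOfLE (le_top : U ≤ ⊤)) q hq a]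
  congr 1
  exact Subtype.ext (funext fun x => hτ ⟨x, trivial⟩ x.2)

end CInfSheaf

/-! ### Softness of the degree zero sheaf -/

theorem mainTheorem5 (X : TopCat.{u}) (O : X.Presheaf (SimplicialObject CInfRingCat.{u}))
    (hO : IsLocalizedSimplicialCInfSpace X O) :
    CInfSheaf.IsSoft (level O 0) := by
  have hT2 : T2Space X := hO.pi0.hausdorff
  obtain ⟨n, e, he⟩ := hO.pi0.finitelyGenerated ⊤
  choose v hv hvu using fun q => (hO.pi0.local_stalk q).exists_point
  choose w hw hwu using fun q => (hO.local_stalk q).exists_point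
  have hind := isInducing_generators hO.pi0.soft e he hv hvu
  refine isSoft_of_hasCutoffs (hO.isSheaf 0) hind fun p => ?_
  choose U hU y hy using fun i => exists_local_lift O (e (SmoothFun.proj i)) p
  -- There are finitely many generators, so their lifts share an open domain, which is the preimage
  -- of an open `G` in `ℝⁿ`.
  obtain ⟨G, hG, hGU⟩ := hind.isOpen_iff.1 (isOpen_iInter_of_finite fun i => (U i).2)
  have hmem := fun q => Set.ext_iff.1 hGU q
  have hmemU : ∀ {q : X} (i : Fin n), _ ∈ G → q ∈ U i := fun {q} i hq =>
    Set.mem_iInter.1 ((hmem q).1 hq) i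
  refine ⟨G, hG, (hmem p).2 (Set.mem_iInter.2 hU), hasCutoffs_of_values hw hwu
    (fun i => germOrZero (y i)) (fun i q hq => isLocalAt_germOrZero (y i) (hmemU i hq))
    fun i q hq => ?_⟩
  -- Uniqueness of the point of the degree zero stalk: the value of a lift there is the value of the
  -- generator it lifts, a coordinate of `Φ`.
  have hvw := (hwu q).eq (hw q) (v := fun a => v q (stalkMap (toSheafPi0 O) q a))
    (isPoint_comp_stalkMap (toSheafPi0 O) q (hv q))
  rw [germOrZero_of_mem (y i) (hmemU i hq), ← hvw]
  exact congrArg (v q) (hy i q (hmemU i hq))
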